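/- Let $X$, $Y$, $Z$ be random variables on a common probability space with values in $\mathbb{R}^{d_X}$, $\mathbb{R}^{d_Y}$, $\mathbb{R}^{d_Z}$ (with Euclidean norms), and let $z\mapsto\mathcal{L}_{X|Z=z}$ and $z\mapsto\mathcal{L}_{Y|Z=z}$ be regular conditional distributions of $X$ and of $Y$ given $Z$. Let $p\in[1,\infty)$, and for probability measures $\mu,\nu$ on a Euclidean space let $$W_p(\mu,\nu)=\inf_{\gamma}\Big(\int\|x-y\|^p\,d\gamma(x,y)\Big)^{1/p}\in[0,\infty],$$ the infimum being over all couplings $\gamma$ of $\mu$ and $\nu$. Suppose that for constants $L_X,L_Y\ge 0$ and all $z,z'\in\operatorname{supp}(\mathcal{L}_Z)$, $$W_p(\mathcal{L}_{X|Z=z},\mathcal{L}_{X|Z=z'})\le L_X|z-z'|,\qquad W_p(\mathcal{L}_{Y|Z=z},\mathcal{L}_{Y|Z=z'})\le L_Y|z-z'|.$$ Let $\varepsilon>0$ and let $\{V_j\}_{j=1}^J$ be a finite measurable partition of $\operatorname{supp}(\mathcal{L}_Z)$ such that for every $j$ $$\operatorname{diam}(V_j)\le\frac{\varepsilon}{\left(2^{p-1}(L_X^p+L_Y^p)\right)^{1/p}}$$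 (the right-hand side being $+\infty$ if $L_X=L_Y=0$). Then for every $j$ with $\mathbb{P}(Z\in V_j)>0$ and every $z_0\in V_j$, $$W_p\left(\mathcal{L}_{X|Z\in V_j}\otimes\mathcal{L}_{Y|Z\in V_j},\ \mathcal{L}_{X|Z=z_0}\otimes\mathcal{L}_{Y|Z=z_0}\right)\le\varepsilon,$$ where $\mathcal{L}_{X|Z\in V_j}$ is the law of $X$ conditioned on the event $Z\in V_j$ (likewise for $Y$) and the product measures live on $\mathbb{R}^{d_X+d_Y}$ with its Euclidean norm. -/

import Mathlib

open MeasureTheory ProbabilityTheory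
open scoped ENNReal NNReal

/-- The couplings of `μ` and `ν`: the measures on `E × E` with marginals `μ` and `ν`. (If `μ` is a
probability measure, every coupling automatically is one.) -/
def couplings {E : Type*} [MeasurableSpace E] (μ ν : Measure E) : Set (Measure (E × E)) :=
  {γ | γ.fst = μ ∧ γ.snd = ν}

/-- The `p`-Wasserstein distance, with values in `[0, ∞]`: the infimum of
`(∫ d(x, y) ^ p dγ(x, y)) ^ (1 / p)` over all couplings `γ` of `μ` and `ν`. -/
noncomputable def wasserstein {E : Type*} [PseudoEMetricSpace E] [MeasurableSpace E]
    (p : ℝ) (μ ν : Measure E) : ℝ≥0∞ :=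
  ⨅ γ ∈ couplings μ ν, (∫⁻ q, edist q.1 q.2 ^ p ∂γ) ^ (1 / p)

/-- `z ↦ κ z` is `L`-Lipschitz with respect to `W_p` on the set `S`. -/
def WassersteinLipschitzOn {E F : Type*} [PseudoEMetricSpace E] [MeasurableSpace E]
    [PseudoEMetricSpace F] [MeasurableSpace F]
    (p : ℝ) (L : ℝ≥0) (κ : Kernel E F) (S : Set E) : Prop :=
  ∀ z ∈ S, ∀ z' ∈ S, wasserstein p (κ z) (κ z') ≤ (L : ℝ≥0∞) * edist z z'

/-- The law of `X` conditioned on the event `Z ∈ V`, which is meant to have positive probability. -/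
noncomputable def lawGivenMem {Ω E F : Type*} [MeasurableSpace Ω] [MeasurableSpace F]
    (P : Measure Ω) (X : Ω → F) (Z : Ω → E) (V : Set E) : Measure F :=
  (ProbabilityTheory.cond P (Z ⁻¹' V)).map X

/-- The product measure `μ ⊗ ν`, on `ℝ^m × ℝ^n` with its Euclidean (`ℓ²`) norm, that is, on
`ℝ^(m + n)`. -/
noncomputable def euclideanProd {m n : ℕ} (μ : Measure (EuclideanSpace ℝ (Fin m)))
    (ν : Measure (EuclideanSpace ℝ (Fin n))) :
    Measure (WithLp 2 (EuclideanSpace ℝ (Fin m) × EuclideanSpace ℝ (Fin n))) :=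
  (μ.prod ν).map (WithLp.toLp 2)

/-- The sets `V 1, …, V J` form a measurable partition of `S`. -/
structure IsMeasurablePartition {E : Type*} [MeasurableSpace E] {J : ℕ}
    (V : Fin J → Set E) (S : Set E) : Prop where
  measurableSet : ∀ j, MeasurableSet (V j)
  disjoint : ∀ i j, i ≠ j → Disjoint (V i) (V j)
  iUnion_eq : ⋃ j, V j = S

/-! The law of `X` given `Z ∈ V j` is a mixture of the laws `κX z`, `z ∈ V j`, each within `LX *
diam (V j)` of `κX z₀`. Mixing couplings of cost at most `b ^ p` gives a coupling of the mixture
with the same bound, so mixtures stay within that distance (`wasserstein_bind_le`).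

Mixing needs couplings that depend measurably on `z`. Measurable selection is avoided by replacing
`z` with finitely valued approximations. The Lipschitz hypothesis makes the approximate mixtures
converge weakly, and `exists_coupling_of_tendsto` (Prokhorov and lower semicontinuity of the cost)
yields a coupling in the limit.

For the products, the independent product of a coupling for `X` and one for `Y` costs at most `2 ^
(p - 1)` times the sum of the two costs. The factor `diam (V j)` then comes out, and its bound gives
`ε`. -/

/-- On a probability space, the `L¹` norm of a distance is at most its `Lᵖ` norm. -/
lemma lintegral_le_lintegral_rpow_rpow_inv {α : Type*} [MeasurableSpace α] {γ : Measure α}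
    [IsProbabilityMeasure γ] {f : α → ℝ≥0∞} (hf : Measurable f) {p : ℝ} (hp : 1 ≤ p) :
    ∫⁻ q, f q ∂γ ≤ (∫⁻ q, f q ^ p ∂γ) ^ (1 / p) := by
  have h := eLpNorm_le_eLpNorm_of_exponent_le (μ := γ) (f := f) (p := 1) (q := ENNReal.ofReal p)
    (by simpa using ENNReal.ofReal_le_ofReal hp) hf.aestronglyMeasurable
  have hp0 : 0 < p := by linarith
  rw [eLpNorm_one_eq_lintegral_enorm, eLpNorm_eq_lintegral_rpow_enorm_toReal (by simpa using hp0)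
    ENNReal.ofReal_ne_top, ENNReal.toReal_ofReal hp0.le] at h
  simpa using h

lemma isProbabilityMeasure_of_mem_couplings {E : Type*} [MeasurableSpace E] {μ ν : Measure E}
    [IsProbabilityMeasure μ] {γ : Measure (E × E)} (hγ : γ ∈ couplings μ ν) :
    IsProbabilityMeasure γ :=
  ⟨by rw [← Measure.fst_univ, hγ.1, measure_univ]⟩

/-- A coupling whose transport cost is nearly optimal. -/
lemma exists_coupling_of_wasserstein_lt {E : Type*} [PseudoEMetricSpace E] [MeasurableSpace E]
    {p : ℝ} (hp : 1 ≤ p) {μ ν : Measure E} {b : ℝ≥0∞} (h : wasserstein p μ ν < b) :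
    ∃ γ ∈ couplings μ ν, ∫⁻ q, edist q.1 q.2 ^ p ∂γ ≤ b ^ p := by
  simp only [wasserstein, iInf_lt_iff] at h
  obtain ⟨γ, hγ, h⟩ := h
  refine ⟨γ, hγ, ?_⟩
  rw [one_div] at h
  exact (ENNReal.rpow_inv_le_iff (by linarith)).1 h.le

lemma wasserstein_le_of_coupling {E : Type*} [PseudoEMetricSpace E] [MeasurableSpace E]
    {p : ℝ} (hp : 1 ≤ p) {μ ν : Measure E} {b : ℝ≥0∞} {γ : Measure (E × E)}
    (hγ : γ ∈ couplings μ ν) (h : ∫⁻ q, edist q.1 q.2 ^ p ∂γ ≤ b ^ p) :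
    wasserstein p μ ν ≤ b := by
  refine (iInf₂_le γ hγ).trans ?_
  rw [one_div]
  exact (ENNReal.rpow_inv_le_iff (by linarith)).2 h

section Compactness

variable {E : Type*} [PseudoMetricSpace E] [SecondCountableTopology E] [MeasurableSpace E]
  [BorelSpace E]

/-- The integral of a Lipschitz function is Lipschitz with respect to the Wasserstein distance. -/
lemma edist_integral_le_mul_wasserstein {p : ℝ} (hp : 1 ≤ p) {μ ν : Measure E}
    [IsProbabilityMeasure μ] [IsProbabilityMeasure ν] {f : E → ℝ} {K : ℝ≥0}
    (hf : LipschitzWith K f) (hμ : Integrable f μ) (hν : Integrable f ν) :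
    edist (∫ x, f x ∂μ) (∫ x, f x ∂ν) ≤ K * wasserstein p μ ν := by
  -- In `[0, ∞]` a zero factor need not pass through an infimum, since an empty infimum is `∞`; but
  -- a `0`-Lipschitz function is constant.
  rcases eq_or_ne K 0 with rfl | hK
  · have hc : ∀ x y, f x = f y := fun x y ↦ by
      have := hf x y
      simpa using this
    obtain ⟨x₀⟩ := nonempty_of_isProbabilityMeasure μ
    have : f = fun _ ↦ f x₀ := funext fun x ↦ hc x x₀
    rw [this]
    simp
  simp only [wasserstein, ENNReal.mul_iInf_of_ne (ENNReal.coe_ne_zero.2 hK) ENNReal.coe_ne_top]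
  refine le_iInf₂ fun γ hγ ↦ ?_
  have := isProbabilityMeasure_of_mem_couplings hγ
  obtain ⟨rfl, rfl⟩ := hγ
  have h1 : Integrable (fun q : E × E ↦ f q.1) γ := hμ.comp_measurable measurable_fst
  have h2 : Integrable (fun q : E × E ↦ f q.2) γ := hν.comp_measurable measurable_snd
  rw [Measure.fst, Measure.snd,
    integral_map measurable_fst.aemeasurable hf.continuous.aestronglyMeasurable,
    integral_map measurable_snd.aemeasurable hf.continuous.aestronglyMeasurable,
    edist_eq_enorm_sub, ← integral_sub h1 h2]
  calc ‖∫ q, (f q.1 - f q.2) ∂γ‖ₑ ≤ ∫⁻ q, ‖f q.1 - f q.2‖ₑ ∂γ := enorm_integral_le_lintegral_enorm _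
    _ ≤ ∫⁻ q, K * edist q.1 q.2 ∂γ := lintegral_mono fun q ↦ by
        simpa [edist_eq_enorm_sub] using hf q.1 q.2
    _ = K * ∫⁻ q, edist q.1 q.2 ∂γ := lintegral_const_mul _ (by fun_prop)
    _ ≤ _ := by gcongr; exact lintegral_le_lintegral_rpow_rpow_inv (by fun_prop) hp

end Compactness

section Complete

variable {E : Type*} [MetricSpace E] [CompleteSpace E] [SecondCountableTopology E]
  [MeasurableSpace E] [BorelSpace E]

open Filter Topology

/-- The transport cost is lower semicontinuous, and couplings of weakly convergent sequences
accumulate at a coupling of the limits. -/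
lemma exists_coupling_of_tendsto {p : ℝ} (hp : 1 ≤ p) {μs νs : ℕ → ProbabilityMeasure E}
    {μ ν : ProbabilityMeasure E} (hμ : Tendsto μs atTop (𝓝 μ)) (hν : Tendsto νs atTop (𝓝 ν))
    {γs : ℕ → Measure (E × E)}
    (hγs : ∀ n, γs n ∈ couplings (μs n : Measure E) (νs n)) {c : ℕ → ℝ≥0∞} {c' : ℝ≥0∞}
    (hc : Tendsto c atTop (𝓝 c')) (hcost : ∀ n, ∫⁻ q, edist q.1 q.2 ^ p ∂(γs n) ≤ c n) :
    ∃ γ ∈ couplings (μ : Measure E) ν, ∫⁻ q, edist q.1 q.2 ^ p ∂γ ≤ c' := by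
  have hprob n := isProbabilityMeasure_of_mem_couplings (hγs n)
  let Γ : ℕ → ProbabilityMeasure (E × E) := fun n ↦ ⟨γs n, hprob n⟩
  -- A convergent sequence together with its limit is compact, hence tight by the converse half of
  -- Prokhorov's theorem. Tight marginals then make the couplings tight.
  have tight {ρs : ℕ → ProbabilityMeasure E} {ρ} (h : Tendsto ρs atTop (𝓝 ρ)) :
      IsTightMeasureSet {((σ : ProbabilityMeasure E) : Measure E) | σ ∈ Set.range ρs} :=
    isTightMeasureSet_of_isCompact_closure
      (h.isCompact_insert_range.closure_of_subset (Set.subset_insert _ _))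
  have hΓ : IsTightMeasureSet
      {((σ : ProbabilityMeasure (E × E)) : Measure (E × E)) | σ ∈ Set.range Γ} := by
    refine IsTightMeasureSet.prodMk ((tight hμ).subset ?_) ((tight hν).subset ?_)
    · rintro _ ⟨_, ⟨_, ⟨n, rfl⟩, rfl⟩, rfl⟩
      exact ⟨μs n, ⟨n, rfl⟩, (hγs n).1.symm⟩
    · rintro _ ⟨_, ⟨_, ⟨n, rfl⟩, rfl⟩, rfl⟩
      exact ⟨νs n, ⟨n, rfl⟩, (hγs n).2.symm⟩
  obtain ⟨γ, -, φ, hφ, hlim⟩ := (isCompact_closure_of_isTightMeasureSet hΓ).tendsto_subseq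
    (x := Γ) fun n ↦ subset_closure ⟨n, rfl⟩
  refine ⟨γ, ⟨?_, ?_⟩, ?_⟩
  · have h1 := ((ProbabilityMeasure.continuous_map continuous_fst).tendsto γ).comp hlim
    have h2 := tendsto_nhds_unique (h1.congr fun n ↦ ?_) (hμ.comp hφ.tendsto_atTop)
    · exact congrArg ProbabilityMeasure.toMeasure h2
    · exact Subtype.ext (hγs (φ n)).1
  · have h1 := ((ProbabilityMeasure.continuous_map continuous_snd).tendsto γ).comp hlim
    have h2 := tendsto_nhds_unique (h1.congr fun n ↦ ?_) (hν.comp hφ.tendsto_atTop)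
    · exact congrArg ProbabilityMeasure.toMeasure h2
    · exact Subtype.ext (hγs (φ n)).2
  · have hp0 : 0 ≤ p := by linarith
    have hedist (q : E × E) : edist q.1 q.2 ^ p = ENNReal.ofReal (dist q.1 q.2 ^ p) := by
      rw [edist_dist, ENNReal.ofReal_rpow_of_nonneg dist_nonneg hp0]
    -- Portmanteau: the cost is continuous and nonnegative, so the liminf inequality on open sets
    -- passes to its integrals.
    have hlsc := lintegral_le_liminf_lintegral_of_forall_isOpen_measure_le_liminf_measure
      (μ := γ) (μs := fun n ↦ γs (φ n)) (f := fun q : E × E ↦ dist q.1 q.2 ^ p)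
      ((continuous_fst.dist continuous_snd).rpow_const fun _ ↦ .inr hp0)
      (fun q ↦ by positivity)
      fun G hG ↦ ProbabilityMeasure.le_liminf_measure_open_of_tendsto hlim hG
    simp only [← hedist] at hlsc
    exact hlsc.trans ((liminf_le_liminf (.of_forall fun n ↦ hcost (φ n))).trans
      (hc.comp hφ.tendsto_atTop).liminf_eq.le)

/-- Optimal couplings exist. -/
lemma exists_coupling_of_wasserstein_le {p : ℝ} (hp : 1 ≤ p) {μ ν : Measure E}
    [IsProbabilityMeasure μ] [IsProbabilityMeasure ν] {b : ℝ≥0∞} (h : wasserstein p μ ν ≤ b) :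
    ∃ γ ∈ couplings μ ν, ∫⁻ q, edist q.1 q.2 ^ p ∂γ ≤ b ^ p := by
  -- The bounds `u n` below decrease strictly to `b`, which requires `b < ∞`; for `b = ∞` any
  -- coupling will do.
  rcases eq_or_ne b ⊤ with rfl | hb
  · refine ⟨μ.prod ν, ⟨by simp [Measure.fst_prod], by simp [Measure.snd_prod]⟩, ?_⟩
    rw [ENNReal.top_rpow_of_pos (by linarith)]
    exact le_top
  obtain ⟨u, -, hu, hlim⟩ := exists_seq_strictAnti_tendsto' (ENNReal.lt_add_right hb one_ne_zero)
  choose γs hγs hcost using fun n ↦ exists_coupling_of_wasserstein_lt hp (h.trans_lt (hu n).1)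
  exact exists_coupling_of_tendsto hp (μ := ⟨μ, ‹_›⟩) (ν := ⟨ν, ‹_›⟩) tendsto_const_nhds
    tendsto_const_nhds hγs ((ENNReal.continuous_rpow_const.tendsto b).comp hlim) hcost

/-- A mixture of probability measures within Wasserstein distance `b` of `ν` is itself
within Wasserstein distance `b` of `ν`. -/
lemma wasserstein_bind_le {G : Type*} [MetricSpace G] [SecondCountableTopology G]
    [MeasurableSpace G] [BorelSpace G] {p : ℝ} (hp : 1 ≤ p) {m : Measure G}
    [IsProbabilityMeasure m] {κ : Kernel G E} [IsMarkovKernel κ] {V : Set G} (hmV : ∀ᵐ z ∂m, z ∈ V)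
    {L : ℝ≥0} (hL : WassersteinLipschitzOn p L κ V) {ν : Measure E} [IsProbabilityMeasure ν]
    {b : ℝ≥0∞} (hb : ∀ z ∈ V, wasserstein p (κ z) ν ≤ b) :
    wasserstein p (m.bind κ) ν ≤ b := by
  obtain ⟨z₀, hz₀⟩ := hmV.exists
  let T := SimpleFunc.approxOn (id : G → G) measurable_id V z₀ hz₀
  have hT n z : T n z ∈ V := SimpleFunc.approxOn_mem measurable_id hz₀ n z
  have hT_lim {z} (hz : z ∈ V) : Tendsto (fun n ↦ T n z) atTop (𝓝 z) :=
    SimpleFunc.tendsto_approxOn measurable_id hz₀ (subset_closure hz)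
  -- This choice need not be measurable in `z`, but `T n` has finite range in `V`, so `z ↦ γ (T n
  -- z)` is measurable all the same.
  choose! γ hγ hcost using fun z hz ↦ exists_coupling_of_wasserstein_le hp (hb z hz)
  have hκT n : Measurable fun z ↦ κ (T n z) := κ.measurable.comp (T n).measurable
  have hγT n : Measurable fun z ↦ γ (T n z) := ((T n).map γ).measurable
  have hmix n : IsProbabilityMeasure (m.bind fun z ↦ κ (T n z)) :=
    isProbabilityMeasure_bind (hκT n).aemeasurable (.of_forall fun _ ↦ inferInstance)
  have hmix' : IsProbabilityMeasure (m.bind κ) :=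
    isProbabilityMeasure_bind κ.measurable.aemeasurable (.of_forall fun _ ↦ inferInstance)
  let μs (n : ℕ) : ProbabilityMeasure E := ⟨m.bind fun z ↦ κ (T n z), hmix n⟩
  let μ : ProbabilityMeasure E := ⟨m.bind κ, hmix'⟩
  have hlim : Tendsto μs atTop (𝓝 μ) := by
    rw [tendsto_iff_forall_lipschitz_integral_tendsto]
    rintro f ⟨C, hC⟩ ⟨K, hK⟩
    obtain ⟨B, hB⟩ : ∃ B, ∀ x, ‖f x‖ ≤ B := by
      obtain ⟨x₀⟩ := nonempty_of_isProbabilityMeasure ν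
      refine ⟨‖f x₀‖ + C, fun x ↦ ?_⟩
      have := hC x x₀
      rw [dist_eq_norm] at this
      linarith [norm_le_norm_add_norm_sub' (f x) (f x₀)]
    have hint (ρ : Measure E) [IsFiniteMeasure ρ] : Integrable f ρ :=
      .of_bound hK.continuous.aestronglyMeasurable B (.of_forall hB)
    -- The Lipschitz property of `κ` enters here: it makes `z ↦ ∫ f dκ z` continuous on `V`, so
    -- dominated convergence applies along `T n z → z`.
    have hFL : LipschitzOnWith (K * L) (fun z ↦ ∫ x, f x ∂(κ z)) V := fun z hz z' hz' ↦ by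
      refine (edist_integral_le_mul_wasserstein hp hK (hint _) (hint _)).trans ?_
      rw [ENNReal.coe_mul, mul_assoc]
      gcongr
      exact hL z hz z' hz'
    have hbind (η : Kernel G E) [IsMarkovKernel η] :
        ∫ x, f x ∂(m.bind η) = ∫ z, ∫ x, f x ∂(η z) ∂m := by
      rw [← Measure.snd_compProd, Measure.snd,
        integral_map measurable_snd.aemeasurable hK.continuous.aestronglyMeasurable]
      exact Measure.integral_compProd ((hint (m ⊗ₘ η).snd).comp_measurable measurable_snd)
    have hbindT n : ∫ x, f x ∂(m.bind fun z ↦ κ (T n z)) = ∫ z, ∫ x, f x ∂(κ (T n z)) ∂m :=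
      have : IsMarkovKernel (⟨fun z ↦ κ (T n z), hκT n⟩ : Kernel G E) := ⟨fun _ ↦
        inferInstanceAs (IsProbabilityMeasure (κ _))⟩
      hbind ⟨fun z ↦ κ (T n z), hκT n⟩
    change Tendsto (fun n ↦ ∫ x, f x ∂(m.bind fun z ↦ κ (T n z))) atTop
      (𝓝 (∫ x, f x ∂(m.bind κ)))
    simp only [hbindT, hbind κ]
    refine tendsto_integral_of_dominated_convergence (fun _ ↦ B)
      (fun n ↦ ((T n).map fun z ↦ ∫ x, f x ∂(κ z)).stronglyMeasurable.aestronglyMeasurable)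
      (integrable_const B) (fun n ↦ .of_forall fun z ↦ ?_) (hmV.mono fun z hz ↦ ?_)
    · simpa using norm_integral_le_of_norm_le_const (μ := κ (T n z)) (.of_forall hB)
    · exact (hFL.continuousOn z hz).tendsto.comp
        (tendsto_nhdsWithin_iff.2 ⟨hT_lim hz, .of_forall fun n ↦ hT n z⟩)
  -- The mixed coupling has marginals `m.bind (κ ∘ T n)` and `ν`, and its cost is an `m`-average of
  -- costs at most `b ^ p`.
  have := exists_coupling_of_tendsto hp hlim (ν := ⟨ν, ‹_›⟩) tendsto_const_nhds
    (γs := fun n ↦ m.bind fun z ↦ γ (T n z)) (fun n ↦ ⟨?_, ?_⟩)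
    (tendsto_const_nhds (x := b ^ p)) fun n ↦ ?_
  · obtain ⟨γ', hγ', h⟩ := this
    exact wasserstein_le_of_coupling hp hγ' h
  · ext s hs
    change (m.bind _).fst s = (m.bind _) s
    rw [Measure.fst_apply hs, Measure.bind_apply (measurable_fst hs) (hγT n).aemeasurable,
      Measure.bind_apply hs (hκT n).aemeasurable]
    refine lintegral_congr fun z ↦ ?_
    rw [← (hγ _ (hT n z)).1, Measure.fst_apply hs]
  · ext s hs
    change (m.bind _).snd s = ν s
    rw [Measure.snd_apply hs, Measure.bind_apply (measurable_snd hs) (hγT n).aemeasurable]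
    calc _ = ∫⁻ _, ν s ∂m := lintegral_congr fun z ↦ by
          rw [← (hγ _ (hT n z)).2, Measure.snd_apply hs]
      _ = ν s := by simp
  · rw [Measure.lintegral_bind (hγT n).aemeasurable (by fun_prop)]
    calc _ ≤ ∫⁻ _, b ^ p ∂m := lintegral_mono fun z ↦ hcost _ (hT n z)
      _ = b ^ p := by simp

end Complete

/-- The law of `X` given `Z ∈ V` is the mixture of the conditional laws `κ z` over `z ∈ V`. -/
lemma lawGivenMem_eq_bind {Ω E F : Type*} [MeasurableSpace Ω] [MeasurableSpace E]
    [MeasurableSpace F] {P : Measure Ω} [IsProbabilityMeasure P] {X : Ω → F} {Z : Ω → E}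
    (hX : Measurable X) (hZ : Measurable Z) {κ : Kernel E F} [IsMarkovKernel κ]
    (hκ : (P.map fun ω ↦ (Z ω, X ω)).IsCondKernel κ) {V : Set E} (hV : MeasurableSet V) :
    lawGivenMem P X Z V = (ProbabilityTheory.cond (P.map Z) V).bind κ := by
  have hdis := hκ.disintegrate
  have hfst : (P.map fun ω ↦ (Z ω, X ω)).fst = P.map Z := by
    rw [Measure.fst_map_prodMk hX]
  rw [hfst] at hdis
  have : IsProbabilityMeasure (P.map Z) := Measure.isProbabilityMeasure_map hZ.aemeasurable
  ext s hs
  -- On the rectangle `V ×ˢ s` the disintegration reads `P (Z ∈ V, X ∈ s) = ∫ z in V, κ z s`;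
  -- dividing by `P (Z ∈ V)` gives the claim.
  have h := congrArg (fun ρ : Measure (E × F) ↦ ρ (V ×ˢ s)) hdis
  simp only [Measure.compProd_apply_prod hV hs,
    Measure.map_apply (hZ.prodMk hX) (hV.prod hs)] at h
  rw [lawGivenMem, Measure.map_apply hX hs, cond_apply (hZ hV),
    Measure.bind_apply hs κ.measurable.aemeasurable, ProbabilityTheory.cond, lintegral_smul_measure,
    h, Measure.map_apply hZ hV]
  rfl

/-- The Wasserstein distance between product measures on an `ℓ²` product. -/
lemma wasserstein_euclideanProd_le {m n : ℕ} {p : ℝ} (hp : 1 ≤ p)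
    {μ₁ μ₂ : Measure (EuclideanSpace ℝ (Fin m))} {ν₁ ν₂ : Measure (EuclideanSpace ℝ (Fin n))}
    [IsProbabilityMeasure μ₁] [IsProbabilityMeasure μ₂] [IsProbabilityMeasure ν₁]
    [IsProbabilityMeasure ν₂] {a b : ℝ≥0∞} (hμ : wasserstein p μ₁ μ₂ ≤ a)
    (hν : wasserstein p ν₁ ν₂ ≤ b) :
    wasserstein p (euclideanProd μ₁ ν₁) (euclideanProd μ₂ ν₂) ≤
      (2 ^ (p - 1) * (a ^ p + b ^ p)) ^ (1 / p) := by
  have hp0 : 0 < p := by linarith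
  obtain ⟨γ, hγ, hγa⟩ := exists_coupling_of_wasserstein_le hp hμ
  obtain ⟨η, hη, hηb⟩ := exists_coupling_of_wasserstein_le hp hν
  have := isProbabilityMeasure_of_mem_couplings hγ
  have := isProbabilityMeasure_of_mem_couplings hη
  let g : ((EuclideanSpace ℝ (Fin m) × EuclideanSpace ℝ (Fin m)) ×
      (EuclideanSpace ℝ (Fin n) × EuclideanSpace ℝ (Fin n))) →
      WithLp 2 (EuclideanSpace ℝ (Fin m) × EuclideanSpace ℝ (Fin n)) ×
        WithLp 2 (EuclideanSpace ℝ (Fin m) × EuclideanSpace ℝ (Fin n)) :=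
    fun q ↦ (WithLp.toLp 2 (q.1.1, q.2.1), WithLp.toLp 2 (q.1.2, q.2.2))
  have htoLp : Measurable (WithLp.toLp 2 :
      EuclideanSpace ℝ (Fin m) × EuclideanSpace ℝ (Fin n) → _) := WithLp.measurable_toLp _ _
  have hg : Measurable g := by fun_prop
  have hfst : ((γ.prod η).map g).fst = euclideanProd γ.fst η.fst := by
    rw [euclideanProd, Measure.fst, Measure.fst, Measure.fst,
      Measure.map_prod_map _ _ measurable_fst measurable_fst, Measure.map_map measurable_fst hg,
      Measure.map_map htoLp (by fun_prop)]
    rfl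
  have hsnd : ((γ.prod η).map g).snd = euclideanProd γ.snd η.snd := by
    rw [euclideanProd, Measure.snd, Measure.snd, Measure.snd,
      Measure.map_prod_map _ _ measurable_snd measurable_snd, Measure.map_map measurable_snd hg,
      Measure.map_map htoLp (by fun_prop)]
    rfl
  refine wasserstein_le_of_coupling hp (γ := (γ.prod η).map g)
    ⟨by rw [hfst, hγ.1, hη.1], by rw [hsnd, hγ.2, hη.2]⟩ ?_
  rw [← ENNReal.rpow_mul, one_div, inv_mul_cancel₀ hp0.ne', ENNReal.rpow_one]
  refine (lintegral_map_le _ _).trans ?_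
  calc ∫⁻ q, edist (g q).1 (g q).2 ^ p ∂(γ.prod η)
      ≤ ∫⁻ q, 2 ^ (p - 1) * (edist q.1.1 q.1.2 ^ p + edist q.2.1 q.2.2 ^ p) ∂(γ.prod η) := by
        refine lintegral_mono fun q ↦ ?_
        refine le_trans ?_ (ENNReal.rpow_add_le_mul_rpow_add_rpow _ _ hp)
        gcongr
        -- The `ℓ²` norm of a pair is at most its `ℓ¹` norm.
        rw [WithLp.prod_edist_eq_add (by norm_num)]
        exact ENNReal.rpow_add_rpow_le_add _ _ (by norm_num)
    _ = 2 ^ (p - 1) * (∫⁻ q, edist q.1 q.2 ^ p ∂γ + ∫⁻ q, edist q.1 q.2 ^ p ∂η) := by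
        rw [lintegral_const_mul _ (by fun_prop), lintegral_add_left (by fun_prop)]
        congr 2
        · rw [lintegral_prod _ (by fun_prop)]
          simp
        · rw [lintegral_prod _ (by fun_prop)]
          simp
    _ ≤ _ := by gcongr

theorem mainTheorem4 {Ω : Type*} [MeasurableSpace Ω] (P : Measure Ω) [IsProbabilityMeasure P]
    {dX dY dZ : ℕ}
    (X : Ω → EuclideanSpace ℝ (Fin dX)) (Y : Ω → EuclideanSpace ℝ (Fin dY))
    (Z : Ω → EuclideanSpace ℝ (Fin dZ))
    (hX : Measurable X) (hY : Measurable Y) (hZ : Measurable Z)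
    -- regular conditional distributions of `X` and of `Y` given `Z`
    (κX : Kernel (EuclideanSpace ℝ (Fin dZ)) (EuclideanSpace ℝ (Fin dX))) [IsMarkovKernel κX]
    (κY : Kernel (EuclideanSpace ℝ (Fin dZ)) (EuclideanSpace ℝ (Fin dY))) [IsMarkovKernel κY]
    (hκX : (P.map fun ω => (Z ω, X ω)).IsCondKernel κX)
    (hκY : (P.map fun ω => (Z ω, Y ω)).IsCondKernel κY)
    (p : ℝ) (hp : 1 ≤ p) (LX LY : ℝ≥0)
    (hLX : WassersteinLipschitzOn p LX κX (P.map Z).support)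
    (hLY : WassersteinLipschitzOn p LY κY (P.map Z).support)
    {J : ℕ} (V : Fin J → Set (EuclideanSpace ℝ (Fin dZ)))
    (hV : IsMeasurablePartition V (P.map Z).support)
    (ε : ℝ) (hε : 0 < ε)
    -- the division is in `[0, ∞]`, so that the right-hand side is `∞` if `LX = LY = 0`
    (hdiam : ∀ j, Metric.ediam (V j) ≤
      ENNReal.ofReal ε / (2 ^ (p - 1) * ((LX : ℝ≥0∞) ^ p + (LY : ℝ≥0∞) ^ p)) ^ (1 / p)) :
    ∀ j, P (Z ⁻¹' V j) ≠ 0 → ∀ z₀ ∈ V j,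
      wasserstein p (euclideanProd (lawGivenMem P X Z (V j)) (lawGivenMem P Y Z (V j)))
        (euclideanProd (κX z₀) (κY z₀)) ≤ ENNReal.ofReal ε := by

  intro j hj z₀ hz₀
  have hp0 : 0 < p := by linarith
  have hVS : V j ⊆ (P.map Z).support := hV.iUnion_eq ▸ Set.subset_iUnion V j
  have hVm := hV.measurableSet j
  have hmj : P.map Z (V j) ≠ 0 := by rwa [Measure.map_apply hZ hVm]
  have : IsProbabilityMeasure (P.map Z) := Measure.isProbabilityMeasure_map hZ.aemeasurable
  have : IsProbabilityMeasure (ProbabilityTheory.cond (P.map Z) (V j)) :=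
    cond_isProbabilityMeasure hmj
  have : IsProbabilityMeasure (ProbabilityTheory.cond P (Z ⁻¹' V j)) :=
    cond_isProbabilityMeasure hj
  have : IsProbabilityMeasure (lawGivenMem P X Z (V j)) :=
    Measure.isProbabilityMeasure_map hX.aemeasurable
  have : IsProbabilityMeasure (lawGivenMem P Y Z (V j)) :=
    Measure.isProbabilityMeasure_map hY.aemeasurable
  have hae : ∀ᵐ z ∂(ProbabilityTheory.cond (P.map Z) (V j)), z ∈ V j := ae_cond_mem hVm
  have hXV : wasserstein p (lawGivenMem P X Z (V j)) (κX z₀) ≤ LX * Metric.ediam (V j) := by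
    rw [lawGivenMem_eq_bind hX hZ hκX hVm]
    refine wasserstein_bind_le hp hae (fun z hz z' hz' ↦ hLX z (hVS hz) z' (hVS hz'))
      fun z hz ↦ (hLX z (hVS hz) z₀ (hVS hz₀)).trans ?_
    gcongr
    exact Metric.edist_le_ediam_of_mem hz hz₀
  have hYV : wasserstein p (lawGivenMem P Y Z (V j)) (κY z₀) ≤ LY * Metric.ediam (V j) := by
    rw [lawGivenMem_eq_bind hY hZ hκY hVm]
    refine wasserstein_bind_le hp hae (fun z hz z' hz' ↦ hLY z (hVS hz) z' (hVS hz'))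
      fun z hz ↦ (hLY z (hVS hz) z₀ (hVS hz₀)).trans ?_
    gcongr
    exact Metric.edist_le_ediam_of_mem hz hz₀
  refine (wasserstein_euclideanProd_le hp hXV hYV).trans ?_
  rw [ENNReal.mul_rpow_of_nonneg _ _ hp0.le, ENNReal.mul_rpow_of_nonneg _ _ hp0.le, ← add_mul,
    ← mul_assoc, ENNReal.mul_rpow_of_nonneg _ _ (by positivity), ← ENNReal.rpow_mul, one_div,
    mul_inv_cancel₀ hp0.ne', ENNReal.rpow_one, ← one_div]
  -- `c * (ε / c) ≤ ε` holds in `[0, ∞]` even for `c = 0`, because `0 * ∞ = 0`; this covers `LX = LY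
  -- = 0`.
  exact (mul_le_mul_right (hdiam j) _).trans ENNReal.mul_div_le
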